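/- Let $0\le k\le n$ be integers and put $\delta=k(n-k)$. For a prime power $q$ let $V=\mathbb F_q^n$, let $V^*$ be its dual, and let $G_k(V)\subset\mathbb P(\bigwedge^kV)$ be the Grassmannian of $k$-dimensional subspaces of $V$ in its Plücker embedding, i.e. the set of points $[b_1\wedge\dots\wedge b_k]$ with $b_1,\dots,b_k$ a basis of a $k$-dimensional subspace of $V$; likewise $G_k(V^*)\subset\mathbb P(\bigwedge^kV^*)$. For $r\ge 1$, a codimension-$r$ linear subspace $L$ of $\mathbb P(\bigwedge^kV)$ is $L=\mathbb P(\hat L)$ with $\hat L\subset\bigwedge^kV$ a linear subspace of codimension $r$. Put $\|L\|=|G_k(V)\setminus L|$ and $$\mathrm{Ann}(L)=\mathbb P\{\omega\in\textstyle\bigwedge^kV^*:\langle\omega,\xi\rangle=0\text{ for all }\xi\in\hat L\},$$ where $\langle f_1\wedge\dots\wedge f_k,\,v_1\wedge\dots\wedge v_k\rangle=\det(f_i(v_j))$. **Theorem.** There is a constant $C$ depending only on $k$ and $n$ such that, for every prime power $q$, every $r\ge1$ and every codimension-$r$ linear subspace $L$ of $\mathbb P(\bigwedge^k\mathbb F_q^n)$: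 1. if $\mathrm{Ann}(L)\subset G_k(V^*)$, then $\|L\|=q^{\delta}+q^{\delta-1}+\dots+q^{\delta-r+1}$; 2. if $\mathrm{Ann}(L)\not\subset G_k(V^*)$ and $r\ge3$, then $\bigl|\,\|L\|-(q^{\delta}+q^{\delta-1}+2q^{\delta-2})\bigr|\le C\,q^{\delta-3}$; 3. if $\mathrm{Ann}(L)\not\subset G_k(V^*)$ and $r=2$, then $\bigl|\,\|L\|-(q^{\delta}+q^{\delta-1}+q^{\delta-2})\bigr|\le C\,q^{\delta-3}$. -/

import Mathlib

open scoped LinearAlgebra.Projectivization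

noncomputable section

namespace PluckerSection

variable {F : Type*} [Field F] {V : Type*} [AddCommGroup V] [Module F V]

variable (F V) in
/-- The Grassmannian `G_k(V)` inside `ℙ(⋀^k V)`, that is, the image of the Plücker embedding:
the points `[b₁ ∧ ⋯ ∧ b_k]` where `b₁, …, b_k` is a basis of a `k`-dimensional
subspace `Λ` of `V`. -/
def grassmannian (k : ℕ) : Set (ℙ F (⋀[F]^k V)) :=
  {P | ∃ (Λ : Submodule F V) (b : Module.Basis (Fin k) F Λ),
    P.submodule = Submodule.span F {exteriorPower.ιMulti F k (fun i => (b i : V))}}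

/-- `Ann(L̂) = {ω ∈ ⋀^k V* : ⟨ω, ξ⟩ = 0 for all ξ ∈ L̂}` for a subspace `L̂` of `⋀^k V`, where
`⟨f₁ ∧ ⋯ ∧ f_k, v₁ ∧ ⋯ ∧ v_k⟩ = det (f_i v_j)`. -/
def ann {k : ℕ} (L : Submodule F (⋀[F]^k V)) : Submodule F (⋀[F]^k (Module.Dual F V)) where
  carrier := {ω | ∀ ξ ∈ L, exteriorPower.pairingDual F V k ω ξ = 0}
  zero_mem' := fun ξ _ => by simp
  add_mem' := fun {a b} ha hb ξ hξ => by simp [ha ξ hξ, hb ξ hξ]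
  smul_mem' := fun c a ha ξ hξ => by simp [ha ξ hξ]

/-- `Ann(L) ⊆ G_k(V*)`, where `L = ℙ(L̂)` and `Ann(L) = ℙ(Ann(L̂))`. -/
def AnnInGrassmannian {k : ℕ} (L : Submodule F (⋀[F]^k V)) : Prop :=
  ((ann L).projectivization : Set (ℙ F (⋀[F]^k (Module.Dual F V)))) ⊆
    grassmannian F (Module.Dual F V) k

/-- `‖L‖ = |G_k(V) \ L|`, the number of points of the Grassmannian outside `L = ℙ(L̂)`. -/
def weight {k : ℕ} (L : Submodule F (⋀[F]^k V)) : ℕ :=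
  (grassmannian F V k \ (L.projectivization : Set (ℙ F (⋀[F]^k V)))).ncard

/-- `δ = k (n - k)`, as an integer, the dimension of the Grassmannian. -/
def delta (k n : ℕ) : ℤ := (k : ℤ) * ((n : ℤ) - (k : ℤ))

end PluckerSection

end

/-! Elements of `ann L` are alternating `k`-forms on `V`, and the proof averages over them. If `v₁ ∧
⋯ ∧ v_k` lies outside `L̂`, exactly a proportion `1 - 1/q` of the forms in `ann L`, a space of
dimension `r`, is nonzero on `(v₁, …, v_k)`; otherwise none is. Each point of the Grassmannian comes
from `|GL_k(q)|` tuples, so `‖L‖` is determined by the sum of `nonvanishing ω` over `ω ∈ ann L`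
(`weight_mul_frameCount`).

A nonzero decomposable form is nonzero on exactly `frameCount = q^δ |GL_k(q)|` tuples. If all of
`ann L` is decomposable, the sum is `(q^r - 1) frameCount`, and a geometric series gives case 1. An
indecomposable form has `1 + q⁻² + O(q⁻³)` times as many such tuples
(`exists_abs_nonvanishing_sub_le`), and as soon as one form of `ann L` is indecomposable, only
`O(1/q)` of them are decomposable. Since the zero form contributes nothing, `‖L‖ (1 - 1/q) = q^δ (1
+ q⁻² - q⁻ʳ + O(q⁻³))`; dividing by `1 - 1/q` gives cases 2 and 3.

Decomposability is a rank condition on the contraction map `v ↦ ω(v, ·)`: for a form of degree `d ≥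
1`, rank at most `d`. Such a condition defines a set that either is the whole space or has density
`O(1/q)` (`card_mul_card_finrank_range_le`). The estimate for indecomposable forms is an induction
on the degree by contraction: a form of degree at least 3 whose contractions are all decomposable is
itself decomposable, so most contractions of an indecomposable form are indecomposable. -/

noncomputable section

namespace PluckerSection

open Module

/-! ### Decomposable forms and the rank of the contraction map -/

section Algebra

variable {F : Type*} [Field F] {V : Type*} [AddCommGroup V] [Module F V]

/-- An alternating form is decomposable if it is a scalar multiple of a form
`v ↦ det (f_j (v_i))`. -/
def IsDecomposable {k : ℕ} (ω : V [⋀^Fin k]→ₗ[F] F) : Prop :=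
  ∃ (c : F) (f : Fin k → Dual F V),
    ∀ v : Fin k → V, ω v = c * (Matrix.of fun i j => f j (v i)).det

theorem map_eq_zero_of_curryLeft_eq_zero {k : ℕ} {ω : V [⋀^Fin (k + 1)]→ₗ[F] F} {x : V}
    (hx : ω.curryLeft x = 0) (w : Fin (k + 1) → V) (i : Fin (k + 1)) (hw : w i = x) :
    ω w = 0 := by
  have h := ω.map_insertNth i (w i) (i.removeNth w)
  rw [Fin.insertNth_self_removeNth] at h
  rw [h, hw, ← AlternatingMap.curryLeft_apply_apply, hx]
  simp

theorem map_eq_zero_of_curryLeft_curryLeft_eq_zero {k : ℕ} {ω : V [⋀^Fin (k + 2)]→ₗ[F] F}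
    {x y : V} (h : (ω.curryLeft x).curryLeft y = 0) (w : Fin (k + 2) → V) (a b : Fin (k + 2))
    (hab : b ≠ a) (ha : w a = x) (hb : w b = y) : ω w = 0 := by
  obtain ⟨c, rfl⟩ := Fin.exists_succAbove_eq hab
  have h1 := ω.map_insertNth a (w a) (a.removeNth w)
  rw [Fin.insertNth_self_removeNth] at h1
  rw [h1, ha, ← AlternatingMap.curryLeft_apply_apply,
    map_eq_zero_of_curryLeft_eq_zero h (a.removeNth w) c hb]
  simp

theorem curryLeft_eq_zero_iff {k : ℕ} {ω : V [⋀^Fin (k + 1)]→ₗ[F] F} :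
    ω.curryLeft = 0 ↔ ω = 0 := by
  refine ⟨fun h => ?_, fun h => by rw [h, AlternatingMap.curryLeft_zero]⟩
  ext w
  exact map_eq_zero_of_curryLeft_eq_zero (by rw [h, LinearMap.zero_apply]) w 0 rfl

theorem curryLeft_curryLeft_swap {k : ℕ} (ω : V [⋀^Fin (k + 2)]→ₗ[F] F) (x y : V) :
    (ω.curryLeft x).curryLeft y = -(ω.curryLeft y).curryLeft x := by
  have h := ω.curryLeft_same (x + y)
  simp only [map_add, AlternatingMap.curryLeft_add, LinearMap.add_apply,
    AlternatingMap.curryLeft_same, zero_add, add_zero] at h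
  rw [add_comm] at h
  exact eq_neg_of_add_eq_zero_left (by rw [← h, add_comm])

/-- The entries of `v` are exchanged for those of `v'` one at a time; each exchange alters `ω` by a
value with an argument in `N`. -/
theorem map_eq_of_sub_mem {k : ℕ} (ω : V [⋀^Fin k]→ₗ[F] F) (N : Submodule F V)
    (hN : ∀ (w : Fin k → V) (i : Fin k), w i ∈ N → ω w = 0) (v v' : Fin k → V)
    (h : ∀ i, v i - v' i ∈ N) : ω v = ω v' := by
  have key : ∀ s : Finset (Fin k), ω (s.piecewise v' v) = ω v := by
    intro s
    induction s using Finset.induction_on with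
    | empty => simp
    | insert j s hj ih =>
      rw [← ih, Finset.piecewise_insert]
      have h2 : s.piecewise v' v = Function.update (s.piecewise v' v) j (v j) := by
        rw [eq_comm, Function.update_eq_self_iff]; simp [hj]
      rw [h2, Function.update_idem, ← sub_eq_zero, ← AlternatingMap.map_update_sub]
      refine hN _ j ?_
      simpa using N.neg_mem (h j)
  simpa using (key Finset.univ).symm

/-- The linear map `w ↦ (ω (e₀, …, w, …, e_k))_j`. -/
def replaceMap {k : ℕ} (ω : V [⋀^Fin k]→ₗ[F] F) (e : Fin k → V) : V →ₗ[F] (Fin k → F) :=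
  LinearMap.pi fun j => ω.toMultilinearMap.toLinearMap e j

theorem replaceMap_apply {k : ℕ} (ω : V [⋀^Fin k]→ₗ[F] F) (e : Fin k → V) (w : V) (j : Fin k) :
    replaceMap ω e w j = ω (Function.update e j w) := rfl

theorem replaceMap_self {k : ℕ} (ω : V [⋀^Fin k]→ₗ[F] F) (e : Fin k → V) (i : Fin k) :
    replaceMap ω e (e i) = Pi.single i (ω e) := by
  ext j
  rw [replaceMap_apply]
  by_cases h : j = i
  · subst h; simp
  · rw [Pi.single_eq_of_ne h]
    exact ω.map_update_self e h

/-- When `ω e ≠ 0`, the kernel of `replaceMap ω e` is a complement to the span of the `e j`; this is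
the projection onto it. -/
theorem sub_mem_ker_replaceMap {k : ℕ} (ω : V [⋀^Fin k]→ₗ[F] F) (e : Fin k → V) (he : ω e ≠ 0)
    (w : V) : w - ∑ j, (replaceMap ω e w j / ω e) • e j ∈ LinearMap.ker (replaceMap ω e) := by
  rw [LinearMap.mem_ker, map_sub, map_sum, sub_eq_zero]
  ext i
  simp [replaceMap_self, Finset.sum_apply, Pi.single_apply, he]

theorem range_replaceMap {k : ℕ} (ω : V [⋀^Fin k]→ₗ[F] F) (e : Fin k → V) (he : ω e ≠ 0) :
    LinearMap.range (replaceMap ω e) = ⊤ := by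
  rw [eq_top_iff]
  intro y _
  refine ⟨∑ j, (y j / ω e) • e j, ?_⟩
  ext i
  simp [replaceMap_self, Finset.sum_apply, Pi.single_apply, he]

theorem ker_curryLeft_le_ker_replaceMap {k : ℕ} (ω : V [⋀^Fin (k + 1)]→ₗ[F] F)
    (e : Fin (k + 1) → V) : LinearMap.ker ω.curryLeft ≤ LinearMap.ker (replaceMap ω e) := by
  intro w hw
  rw [LinearMap.mem_ker] at hw ⊢
  ext j
  exact map_eq_zero_of_curryLeft_eq_zero hw _ j (by simp)

variable [FiniteDimensional F V]

theorem finrank_ker_replaceMap {k : ℕ} (ω : V [⋀^Fin k]→ₗ[F] F) (e : Fin k → V) (he : ω e ≠ 0) :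
    k + finrank F (LinearMap.ker (replaceMap ω e)) = finrank F V := by
  rw [← LinearMap.finrank_range_add_finrank_ker (replaceMap ω e), range_replaceMap ω e he]
  simp

theorem le_finrank_range_curryLeft {k : ℕ} {ω : V [⋀^Fin (k + 1)]→ₗ[F] F} (hω : ω ≠ 0) :
    k + 1 ≤ finrank F (LinearMap.range ω.curryLeft) := by
  obtain ⟨e, he⟩ : ∃ e, ω e ≠ 0 := by
    by_contra! h
    exact hω (AlternatingMap.ext h)
  have h1 := finrank_ker_replaceMap ω e he
  have h2 := LinearMap.finrank_range_add_finrank_ker ω.curryLeft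
  have h3 := Submodule.finrank_mono (ker_curryLeft_le_ker_replaceMap ω e)
  omega

/-- The kernel of the contraction map lies in that of `replaceMap ω e`, whose codimension is exactly
`k + 1`. The rank bound therefore says that the two kernels coincide, which can be tested on a
single frame `e`. -/
theorem finrank_range_curryLeft_le_iff {k : ℕ} (ω : V [⋀^Fin (k + 1)]→ₗ[F] F)
    (e : Fin (k + 1) → V) (he : ω e ≠ 0) :
    finrank F (LinearMap.range ω.curryLeft) ≤ k + 1 ↔
      ∀ w, (∀ j, ω (Function.update e j w) = 0) → ω.curryLeft w = 0 := by
  have h1 := finrank_ker_replaceMap ω e he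
  have h2 := LinearMap.finrank_range_add_finrank_ker ω.curryLeft
  have h3 := ker_curryLeft_le_ker_replaceMap ω e
  constructor
  · intro h w hw
    have h4 := Submodule.eq_of_le_of_finrank_le h3 (by omega)
    rw [← LinearMap.mem_ker, h4, LinearMap.mem_ker]
    ext j
    exact hw j
  · intro h
    have h4 : LinearMap.ker (replaceMap ω e) ≤ LinearMap.ker ω.curryLeft := by
      intro w hw
      exact h w fun j => congrFun hw j
    have h5 := Submodule.finrank_mono h4
    omega

/-- A nonzero `ω` descends to the quotient by the kernel of its contraction map. That quotient has
dimension `k + 1`, so there a form of degree `k + 1` is a multiple of the determinant. -/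
theorem isDecomposable_of_finrank_le {k : ℕ} {ω : V [⋀^Fin (k + 1)]→ₗ[F] F}
    (h : finrank F (LinearMap.range ω.curryLeft) ≤ k + 1) : IsDecomposable ω := by
  by_cases hω : ω = 0
  · exact ⟨0, 0, fun v => by simp [hω]⟩
  have hr := le_antisymm h (le_finrank_range_curryLeft hω)
  set N := LinearMap.ker ω.curryLeft
  have hN : ∀ (w : Fin (k + 1) → V) (i : Fin (k + 1)), w i ∈ N → ω w = 0 := fun w i hi =>
    map_eq_zero_of_curryLeft_eq_zero hi w i rfl
  let b : Basis (Fin (k + 1)) F (V ⧸ N) := finBasisOfFinrankEq F _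
    ((LinearEquiv.finrank_eq ω.curryLeft.quotKerEquivRange).trans hr)
  obtain ⟨s, hs⟩ := N.mkQ.exists_rightInverse_of_surjective (Submodule.range_mkQ N)
  refine ⟨ω.compLinearMap s b, fun j => b.coord j ∘ₗ N.mkQ, fun v => ?_⟩
  have h1 : ω v = ω.compLinearMap s (fun i => N.mkQ (v i)) := by
    refine map_eq_of_sub_mem ω N hN _ _ fun i => ?_
    exact (Submodule.Quotient.eq N).1 (LinearMap.congr_fun hs (N.mkQ (v i))).symm
  rw [h1]
  conv_lhs => rw [(ω.compLinearMap s).eq_smul_basis_det b]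
  rw [AlternatingMap.smul_apply, smul_eq_mul, Basis.det_apply, ← Matrix.det_transpose]
  rfl

theorem IsDecomposable.finrank_le {k : ℕ} {ω : V [⋀^Fin (k + 1)]→ₗ[F] F}
    (h : IsDecomposable ω) : finrank F (LinearMap.range ω.curryLeft) ≤ k + 1 := by
  obtain ⟨c, f, hf⟩ := h
  have h1 : LinearMap.ker (LinearMap.pi f) ≤ LinearMap.ker ω.curryLeft := by
    intro w hw
    ext v
    rw [AlternatingMap.curryLeft_apply_apply, hf, Matrix.det_eq_zero_of_row_eq_zero 0]
    · simp
    · intro j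
      exact congrFun hw j
  have h2 := LinearMap.finrank_range_add_finrank_ker ω.curryLeft
  have h3 := LinearMap.finrank_range_add_finrank_ker (LinearMap.pi f)
  have h4 := Submodule.finrank_mono h1
  have h5 := Submodule.finrank_le (LinearMap.range (LinearMap.pi f))
  rw [Module.finrank_fin_fun] at h5
  omega

theorem isDecomposable_iff {k : ℕ} {ω : V [⋀^Fin (k + 1)]→ₗ[F] F} :
    IsDecomposable ω ↔ finrank F (LinearMap.range ω.curryLeft) ≤ k + 1 :=
  ⟨IsDecomposable.finrank_le, isDecomposable_of_finrank_le⟩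

omit [FiniteDimensional F V] in
theorem isDecomposable_fin_zero (ω : V [⋀^Fin 0]→ₗ[F] F) : IsDecomposable ω :=
  ⟨ω 0, 0, fun v => by simp [Subsingleton.elim v 0]⟩

omit [FiniteDimensional F V] in
theorem isDecomposable_fin_one (ω : V [⋀^Fin 1]→ₗ[F] F) : IsDecomposable ω := by
  refine ⟨1, fun _ => ω.toMultilinearMap.toLinearMap 0 0, fun v => ?_⟩
  simp only [Matrix.det_unique, Matrix.of_apply, one_mul]
  change ω v = ω (Function.update 0 0 (v 0))
  congr 1
  ext i
  rw [Subsingleton.elim i 0]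
  simp

/-- If `ω(v, ·)` is nonzero, its contraction map kills everything that the one of `ω` kills and also
`v`, so the rank drops by at least one. -/
theorem IsDecomposable.curryLeft {k : ℕ} {ω : V [⋀^Fin (k + 1)]→ₗ[F] F} (h : IsDecomposable ω)
    (v : V) : IsDecomposable (ω.curryLeft v) := by
  obtain _ | k := k
  · exact isDecomposable_fin_zero _
  by_cases hv : ω.curryLeft v = 0
  · exact ⟨0, 0, fun w => by simp [hv]⟩
  rw [isDecomposable_iff] at h ⊢
  have h1 : LinearMap.ker ω.curryLeft < LinearMap.ker (ω.curryLeft v).curryLeft := by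
    refine lt_of_le_of_ne (fun w hw => ?_) fun heq => hv ?_
    · rw [LinearMap.mem_ker] at hw ⊢
      rw [curryLeft_curryLeft_swap, hw]
      simp
    · rw [← LinearMap.mem_ker, heq, LinearMap.mem_ker]
      exact ω.curryLeft_same v
  have h2 := Submodule.finrank_lt_finrank_of_lt h1
  have h3 := LinearMap.finrank_range_add_finrank_ker ω.curryLeft
  have h4 := LinearMap.finrank_range_add_finrank_ker (ω.curryLeft v).curryLeft
  omega

/-- A form of degree at least three is decomposable as soon as all its contractions are. -/
theorem isDecomposable_of_forall_curryLeft {k : ℕ} {ω : V [⋀^Fin (k + 3)]→ₗ[F] F}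
    (h : ∀ v, IsDecomposable (ω.curryLeft v)) : IsDecomposable ω := by
  by_cases hω : ω = 0
  · exact ⟨0, 0, fun v => by simp [hω]⟩
  obtain ⟨e, he⟩ : ∃ e, ω e ≠ 0 := by
    by_contra! h
    exact hω (AlternatingMap.ext h)
  rw [isDecomposable_iff, finrank_range_curryLeft_le_iff ω e he]
  -- The contraction by `e i` is decomposable and nonzero on the remaining `e j`, so the kernel
  -- criterion applies to it with that smaller frame.
  have key1 : ∀ (i : Fin (k + 3)) (u : V), (∀ j, ω (Function.update e j u) = 0) →
      (ω.curryLeft (e i)).curryLeft u = 0 := by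
    intro i u hu
    refine (finrank_range_curryLeft_le_iff (ω.curryLeft (e i)) (i.removeNth e) ?_).1
      (h (e i)).finrank_le u fun j => ?_
    · intro h0
      apply he
      have h1 := ω.map_insertNth i (e i) (i.removeNth e)
      rw [Fin.insertNth_self_removeNth] at h1
      rw [h1, ← AlternatingMap.curryLeft_apply_apply, h0, smul_zero]
    · have h1 := ω.map_insertNth i (e i) (Function.update (i.removeNth e) j u)
      rw [Fin.insertNth_update, Fin.insertNth_self_removeNth, hu] at h1
      rw [AlternatingMap.curryLeft_apply_apply]
      rcases neg_one_pow_eq_or ℤ (i : ℕ) with h2 | h2 <;> rw [h2] at h1 <;> simpa using h1.symm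
  -- The same criterion for the contraction by `e 0 + u`, which takes the value `ω e ≠ 0` on the
  -- tail of `e`. Removing the `e 0` part by `key1` leaves the contraction by `u` and `u'`.
  have key2 : ∀ u u' : V, (∀ j, ω (Function.update e j u) = 0) →
      (∀ j, ω (Function.update e j u') = 0) → (ω.curryLeft u).curryLeft u' = 0 := by
    intro u u' hu hu'
    have hcons : ∀ w : Fin (k + 2) → V, ω.curryLeft (e 0 + u) w =
        ω (Matrix.vecCons (e 0) w) + ω (Matrix.vecCons u w) := by
      intro w
      rw [map_add, AlternatingMap.add_apply, AlternatingMap.curryLeft_apply_apply,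
        AlternatingMap.curryLeft_apply_apply]
    have h1 : (ω.curryLeft (e 0 + u)).curryLeft u' = 0 := by
      refine (finrank_range_curryLeft_le_iff (ω.curryLeft (e 0 + u)) (Fin.tail e) ?_).1
        (h _).finrank_le u' fun j => ?_
      · have h2 : Matrix.vecCons u (Fin.tail e) = Function.update e 0 u := by
          rw [← Fin.cons_self_tail e, Fin.update_cons_zero]; rfl
        have h3 : Matrix.vecCons (e 0) (Fin.tail e) = e := Fin.cons_self_tail e
        rw [hcons, h2, hu, h3, add_zero]
        exact he
      · have h3 : Matrix.vecCons (e 0) (Function.update (Fin.tail e) j u') =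
            Function.update e j.succ u' := by
          conv_rhs => rw [← Fin.cons_self_tail e, ← Fin.cons_update]
          rfl
        rw [hcons, h3, hu', zero_add]
        -- Degree at least 3 is used here: some `e i.succ` survives the replacement at `j` and meets
        -- `u`, so `key1` applies.
        obtain ⟨i, hi⟩ := exists_ne j
        refine map_eq_zero_of_curryLeft_curryLeft_eq_zero (key1 i.succ u hu) _ i.succ 0
          (Fin.succ_ne_zero i).symm ?_ rfl
        change Function.update (Fin.tail e) j u' i = _
        rw [Function.update_of_ne hi]
        rfl
    rw [map_add, AlternatingMap.curryLeft_add, LinearMap.add_apply, key1 0 u' hu', zero_add] at h1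
    exact h1
  intro u hu
  rw [← curryLeft_eq_zero_iff]
  ext1 w
  have hw := sub_mem_ker_replaceMap ω e he w
  rw [← sub_add_cancel w (∑ j, (replaceMap ω e w j / ω e) • e j), map_add,
    key2 u _ hu (fun j => congrFun hw j), zero_add, map_sum, LinearMap.zero_apply]
  refine Finset.sum_eq_zero fun j _ => ?_
  rw [map_smul, curryLeft_curryLeft_swap, key1 j u hu]
  simp

end Algebra

/-! ### Counting over a finite field: low-rank members of a linear family and nonvanishing tuples -/

section Counting

variable {F : Type*} [Field F] [Fintype F] {V : Type*} [AddCommGroup V] [Module F V] [Fintype V]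

/-- If `T x₀` has rank greater than `m` for one `x₀`, then `T x` has rank at most `m` for at most
`(m + 1) / |F|` of all `x`. -/
theorem card_mul_card_finrank_range_le {X Y : Type*} [AddCommGroup X] [Module F X] [Fintype X]
    [AddCommGroup Y] [Module F Y] (m : ℕ) (T : X →ₗ[F] V →ₗ[F] Y) (x₀ : X)
    (h : m + 1 ≤ finrank F (LinearMap.range (T x₀))) :
    Fintype.card F * Nat.card {x // finrank F (LinearMap.range (T x)) ≤ m} ≤
      (m + 1) * Fintype.card X := by
  classical
  obtain ⟨f, hf⟩ := exists_linearIndependent_of_le_finrank h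
  choose v hv using fun i => (f i).2
  let A : (Fin (m + 1) → F) →ₗ[F] V := Fintype.linearCombination F v
  have hA : LinearMap.ker (T x₀ ∘ₗ A) = ⊥ := by
    refine LinearMap.ker_eq_bot'.2 fun c hc => ?_
    have h1 : ∑ i, c i • f i = 0 := by
      apply Subtype.ext
      rw [ZeroMemClass.coe_zero, ← hc, LinearMap.comp_apply, Fintype.linearCombination_apply,
        map_sum]
      simp [hv]
    exact funext (Fintype.linearIndependent_iff.1 hf c h1)
  obtain ⟨B, hB⟩ := (T x₀ ∘ₗ A).exists_leftInverse_of_injective hA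
  -- On each line in direction `x₀`, compressing by `A` and `B` turns `T (x + t • x₀)` into `P + t`
  -- on `F^(m+1)`. Rank at most `m` makes this singular, so `-t` is one of the at most `m + 1` roots
  -- of the characteristic polynomial of `P`.
  have hline : ∀ x : X,
      Nat.card {t : F // finrank F (LinearMap.range (T (x + t • x₀))) ≤ m} ≤ m + 1 := by
    intro x
    let P : End F (Fin (m + 1) → F) := B ∘ₗ T x ∘ₗ A
    have hroot : ∀ t : F, finrank F (LinearMap.range (T (x + t • x₀))) ≤ m →
        -t ∈ P.charpoly.roots.toFinset := by
      intro t ht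
      rw [Multiset.mem_toFinset, Polynomial.mem_roots P.charpoly_monic.ne_zero,
        ← Module.End.hasEigenvalue_iff_isRoot_charpoly, Module.End.hasEigenvalue_iff,
        Module.End.eigenspace_def]
      intro hbot
      have h1 : P - -t • 1 = B ∘ₗ T (x + t • x₀) ∘ₗ A := by
        refine LinearMap.ext fun c => ?_
        have h2 : B (T x₀ (A c)) = c := LinearMap.congr_fun hB c
        simp only [P, LinearMap.sub_apply, LinearMap.smul_apply, Module.End.one_apply,
          LinearMap.comp_apply, map_add, map_smul, LinearMap.add_apply, h2, neg_smul,
          sub_neg_eq_add]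
      rw [h1] at hbot
      have h2 := LinearMap.finrank_range_of_inj (LinearMap.ker_eq_bot.1 hbot)
      rw [LinearMap.range_comp, Module.finrank_fin_fun] at h2
      have h3 := Submodule.finrank_map_le B (LinearMap.range (T (x + t • x₀) ∘ₗ A))
      have h4 := Submodule.finrank_mono (LinearMap.range_comp_le_range A (T (x + t • x₀)))
      omega
    calc Nat.card {t : F // finrank F (LinearMap.range (T (x + t • x₀))) ≤ m}
        ≤ Nat.card P.charpoly.roots.toFinset := Nat.card_le_card_of_injective
          (fun t => ⟨-t.1, hroot t.1 t.2⟩) fun s t hst => by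
            simpa [Subtype.ext_iff] using hst
      _ = P.charpoly.roots.toFinset.card := by
        rw [Nat.card_eq_fintype_card, Fintype.card_coe]
      _ ≤ Multiset.card P.charpoly.roots := Multiset.toFinset_card_le _
      _ ≤ P.charpoly.natDegree := Polynomial.card_roots' _
      _ = m + 1 := by rw [LinearMap.charpoly_natDegree, Module.finrank_fin_fun]
  calc Fintype.card F * Nat.card {x // finrank F (LinearMap.range (T x)) ≤ m}
      = Nat.card (F × {x // finrank F (LinearMap.range (T x)) ≤ m}) := by
        rw [Nat.card_prod, Nat.card_eq_fintype_card (α := F)]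
    -- A bad point `x` and a scalar `s` give a bad parameter `s` on the line through `x - s • x₀`,
    -- and both can be recovered from it.
    _ ≤ Nat.card (Σ x : X, {t : F // finrank F (LinearMap.range (T (x + t • x₀))) ≤ m}) :=
        Nat.card_le_card_of_injective
          (fun p => ⟨p.2.1 - p.1 • x₀, p.1, by rw [sub_add_cancel]; exact p.2.2⟩) (by
          rintro ⟨s, x, hx⟩ ⟨t, y, hy⟩ hst
          have h1 : x - s • x₀ = y - t • x₀ := congrArg Sigma.fst hst
          have h2 : s = t := congrArg (fun p => (p.2 : F)) hst
          subst h2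
          obtain rfl := sub_left_injective h1
          rfl)
    _ = ∑ x : X, Nat.card {t : F // finrank F (LinearMap.range (T (x + t • x₀))) ≤ m} :=
        Nat.card_sigma
    _ ≤ ∑ _x : X, (m + 1) := Finset.sum_le_sum fun x _ => hline x
    _ = (m + 1) * Fintype.card X := by simp [mul_comm]

/-- The number of tuples on which an alternating form does not vanish. -/
def nonvanishing {k : ℕ} (ω : V [⋀^Fin k]→ₗ[F] F) : ℕ :=
  Nat.card {v : Fin k → V // ω v ≠ 0}

omit [Fintype F] in
theorem nonvanishing_zero {k : ℕ} : nonvanishing (0 : V [⋀^Fin k]→ₗ[F] F) = 0 := by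
  simp [nonvanishing]

omit [Fintype F] in
theorem nonvanishing_succ {k : ℕ} (ω : V [⋀^Fin (k + 1)]→ₗ[F] F) :
    nonvanishing ω = ∑ v, nonvanishing (ω.curryLeft v) := by
  unfold nonvanishing
  rw [← Nat.card_sigma]
  refine Nat.card_congr
    { toFun := fun w => ⟨w.1 0, Fin.tail w.1, ?_⟩
      invFun := fun p => ⟨Matrix.vecCons p.1 p.2.1, p.2.2⟩
      left_inv := fun w => Subtype.ext (Fin.cons_self_tail w.1)
      right_inv := fun p => rfl }
  have h := w.2
  rw [← Fin.cons_self_tail w.1] at h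
  exact h

/-- The product `∏_{i < k} (q^n - q^{n - i - 1})`, written without truncated subtraction. -/
def frameCount (q : ℝ) (n k : ℕ) : ℝ := ∏ i ∈ Finset.range k, (q ^ n - q ^ n / q ^ (i + 1))

theorem frameCount_succ (q : ℝ) (n k : ℕ) :
    frameCount q n (k + 1) = frameCount q n k * (q ^ n - q ^ n / q ^ (k + 1)) :=
  Finset.prod_range_succ _ _

theorem frameCount_nonneg {q : ℝ} (hq : 1 ≤ q) (n k : ℕ) : 0 ≤ frameCount q n k :=
  Finset.prod_nonneg fun i _ =>
    sub_nonneg.2 (div_le_self (by positivity) (one_le_pow₀ hq))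

theorem card_ker_eq {Y : Type*} [AddCommGroup Y] [Module F Y] (T : V →ₗ[F] Y) :
    (Nat.card {v // T v = 0} : ℝ) = (Fintype.card F : ℝ) ^ finrank F V /
      (Fintype.card F : ℝ) ^ finrank F (LinearMap.range T) := by
  have hq : (Fintype.card F : ℝ) ≠ 0 := by simp
  have h1 : Nat.card {v // T v = 0} = Fintype.card F ^ finrank F (LinearMap.ker T) := by
    rw [← Nat.card_eq_fintype_card (α := F), ← Module.natCard_eq_pow_finrank (K := F)]
    rfl
  rw [h1, ← LinearMap.finrank_range_add_finrank_ker T, pow_add, Nat.cast_pow]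
  field_simp

theorem card_ne_zero_eq {Y : Type*} [AddCommGroup Y] [Module F Y] (T : V →ₗ[F] Y) :
    (Nat.card {v // T v ≠ 0} : ℝ) = (Fintype.card F : ℝ) ^ finrank F V -
      (Fintype.card F : ℝ) ^ finrank F V /
        (Fintype.card F : ℝ) ^ finrank F (LinearMap.range T) := by
  classical
  rw [← card_ker_eq, eq_sub_iff_add_eq, Nat.card_eq_fintype_card, Nat.card_eq_fintype_card,
    ← Nat.cast_add, add_comm, Fintype.card_subtype_compl (fun v => T v = 0),
    Nat.add_sub_cancel' (Fintype.card_subtype_le _), Module.card_eq_pow_finrank (K := F),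
    Nat.cast_pow]

/-- Contractions stay decomposable, and exactly `q^n - q^n / q^(k+1)` of them are nonzero because
the contraction map has rank `k + 1`; each nonzero one has the same count by induction. -/
theorem nonvanishing_of_isDecomposable {k : ℕ} (ω : V [⋀^Fin k]→ₗ[F] F) (hω : ω ≠ 0)
    (h : IsDecomposable ω) :
    (nonvanishing ω : ℝ) = frameCount (Fintype.card F) (finrank F V) k := by
  classical
  induction k with
  | zero =>
    have h0 : ω 0 ≠ 0 := fun h0 => hω (by ext v; rw [Subsingleton.elim v 0, h0]; rfl)
    have : Unique {v : Fin 0 → V // ω v ≠ 0} :=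
      { default := ⟨0, h0⟩, uniq := fun v => Subtype.ext (Subsingleton.elim _ _) }
    simp [nonvanishing, frameCount]
  | succ k ih =>
    have h1 : ∀ v, (nonvanishing (ω.curryLeft v) : ℝ) =
        if ω.curryLeft v ≠ 0 then frameCount (Fintype.card F) (finrank F V) k else 0 := by
      intro v
      split_ifs with hv
      · exact ih _ hv (h.curryLeft v)
      · rw [not_not.1 hv, nonvanishing_zero, Nat.cast_zero]
    rw [nonvanishing_succ, Nat.cast_sum, Finset.sum_congr rfl fun v _ => h1 v,
      ← Finset.sum_filter, Finset.sum_const, nsmul_eq_mul, ← Fintype.card_subtype,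
      ← Nat.card_eq_fintype_card, card_ne_zero_eq,
      le_antisymm h.finrank_le (le_finrank_range_curryLeft hω), frameCount_succ, mul_comm]

theorem card_mul_card_isDecomposable_le {X : Type*} [AddCommGroup X] [Module F X] [Fintype X]
    {k : ℕ} (T : X →ₗ[F] V [⋀^Fin (k + 1)]→ₗ[F] F) (x₀ : X) (h : ¬ IsDecomposable (T x₀)) :
    Fintype.card F * Nat.card {x // IsDecomposable (T x)} ≤ (k + 2) * Fintype.card X := by
  let T' : X →ₗ[F] V →ₗ[F] V [⋀^Fin k]→ₗ[F] F := AlternatingMap.curryLeftLinearMap ∘ₗ T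
  have hT : ∀ x, IsDecomposable (T x) ↔ finrank F (LinearMap.range (T' x)) ≤ k + 1 :=
    fun x => isDecomposable_iff
  rw [hT] at h
  simp only [hT]
  exact card_mul_card_finrank_range_le (k + 1) T' x₀ (not_le.1 h)

end Counting

/-! ### Nonvanishing count of an indecomposable form -/

section Bounds

/-- Up to the factor `N * D` the difference is `(1 - q⁻ᵐ) - (1 - q⁻²)(1 + q⁻²) = q⁻⁴ - q⁻ᵐ`, which
is `O(q⁻³)` for `m ≥ 3`. The constant 2 absorbs `1 - q⁻² ≥ 1/2`. -/
theorem abs_mul_one_sub_le {N D q : ℝ} {j m : ℕ} (hN : 0 ≤ N) (hD : 0 ≤ D) (hq : 2 ≤ q)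
    (hm : 3 ≤ m) (hj : j = 2) :
    |(N - N / q ^ m) * D - D * (N - N / q ^ j) * (1 + 1 / q ^ 2)| ≤
      2 / q ^ 3 * (D * (N - N / q ^ j)) := by
  subst hj
  have hq0 : 0 < q := by linarith
  have h1 : 1 / q ^ m ≤ 1 / q ^ 3 :=
    one_div_le_one_div_of_le (by positivity) (pow_le_pow_right₀ (by linarith) hm)
  have h2 : 1 / q ^ 4 ≤ 1 / q ^ 3 :=
    one_div_le_one_div_of_le (by positivity) (pow_le_pow_right₀ (by linarith) (by norm_num))
  have h3 : 1 / q ^ 2 ≤ 1 / 2 :=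
    one_div_le_one_div_of_le (by positivity) (by nlinarith)
  have h4 : 0 < 1 / q ^ m := by positivity
  have h5 : 0 < 1 / q ^ 4 := by positivity
  have h6 : 0 < 1 / q ^ 3 := by positivity
  have e1 : (N - N / q ^ m) * D - D * (N - N / q ^ 2) * (1 + 1 / q ^ 2) =
      N * D * (1 / q ^ 4 - 1 / q ^ m) := by field_simp; ring
  have e2 : 2 / q ^ 3 * (D * (N - N / q ^ 2)) = N * D * (1 / q ^ 3 * (2 * (1 - 1 / q ^ 2))) := by
    field_simp
  rw [e1, e2, abs_mul, abs_of_nonneg (by positivity : 0 ≤ N * D)]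
  refine mul_le_mul_of_nonneg_left ?_ (by positivity)
  rw [abs_le]
  constructor <;> nlinarith

/-- Arithmetic of the induction step, in units of `N D q⁻³`: the induction hypothesis costs `C`, the
`A` decomposable contractions `j + 1`, the zero contractions 1, and replacing `N` by `N - N /
q^(j+1)` costs 2. The outer factor 2 comes from `N ≤ 2 (N - N / q^(j+1))`. -/
theorem abs_sum_sub_le {N D S q C : ℝ} {j m : ℕ} (hN : 0 ≤ N) (hD : 0 ≤ D) (hq : 2 ≤ q)
    (hC : 0 ≤ C) (hj : 2 ≤ j) (hm : 3 ≤ m) {A : ℝ} (hA : q * A ≤ (j + 1) * N)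
    (hS : |S - N * (D * (1 + 1 / q ^ 2))| ≤
      N * (C / q ^ 3 * D) + A * (1 / q ^ 2 * D) + N / q ^ m * D) :
    |S - D * (N - N / q ^ (j + 1)) * (1 + 1 / q ^ 2)| ≤
      2 * (C + j + 4) / q ^ 3 * (D * (N - N / q ^ (j + 1))) := by
  have hq0 : 0 < q := by linarith
  have h1 : 1 / q ^ m ≤ 1 / q ^ 3 :=
    one_div_le_one_div_of_le (by positivity) (pow_le_pow_right₀ (by linarith) hm)
  have h2 : 1 / q ^ (j + 1) ≤ 1 / q ^ 3 :=
    one_div_le_one_div_of_le (by positivity) (pow_le_pow_right₀ (by linarith) (by omega))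
  have h3 : 1 / q ^ 2 ≤ 1 / 2 :=
    one_div_le_one_div_of_le (by positivity) (by nlinarith)
  have h3' : 1 / q ^ 3 ≤ 1 / 2 :=
    one_div_le_one_div_of_le (by positivity) (by nlinarith [sq_nonneg (q - 1)])
  have h4 : 0 < 1 / q ^ (j + 1) := by positivity
  have h6 : 0 < 1 / q ^ 3 := by positivity
  have h7 : 0 < 1 / q ^ 2 := by positivity
  have hND : 0 ≤ N * D := by positivity
  have hA' : A * (1 / q ^ 2 * D) ≤ (j + 1) * (N * D * (1 / q ^ 3)) := by
    have e : A * (1 / q ^ 2 * D) = q * A * (1 / q ^ 3 * D) := by field_simp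
    rw [e]
    calc q * A * (1 / q ^ 3 * D) ≤ (j + 1) * N * (1 / q ^ 3 * D) :=
          mul_le_mul_of_nonneg_right hA (by positivity)
      _ = _ := by ring
  have hm' : N / q ^ m * D ≤ N * D * (1 / q ^ 3) := by
    calc N / q ^ m * D = N * D * (1 / q ^ m) := by ring
      _ ≤ _ := mul_le_mul_of_nonneg_left h1 hND
  have hlast : |N * (D * (1 + 1 / q ^ 2)) - D * (N - N / q ^ (j + 1)) * (1 + 1 / q ^ 2)| ≤
      2 * (N * D * (1 / q ^ 3)) := by
    have e : N * (D * (1 + 1 / q ^ 2)) - D * (N - N / q ^ (j + 1)) * (1 + 1 / q ^ 2) =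
        N * D * (1 / q ^ (j + 1) * (1 + 1 / q ^ 2)) := by ring
    rw [e, abs_of_nonneg (by positivity)]
    calc N * D * (1 / q ^ (j + 1) * (1 + 1 / q ^ 2))
        ≤ N * D * (1 / q ^ 3 * 2) := mul_le_mul_of_nonneg_left
          (mul_le_mul h2 (by linarith) (by positivity) (by positivity)) hND
      _ = _ := by ring
  have hfin : N * D ≤ 2 * (D * (N - N / q ^ (j + 1))) := by
    have e : 2 * (D * (N - N / q ^ (j + 1))) = N * D * (2 * (1 - 1 / q ^ (j + 1))) := by ring
    rw [e]
    exact le_mul_of_one_le_right hND (by linarith)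
  calc |S - D * (N - N / q ^ (j + 1)) * (1 + 1 / q ^ 2)|
      ≤ |S - N * (D * (1 + 1 / q ^ 2))| +
        |N * (D * (1 + 1 / q ^ 2)) - D * (N - N / q ^ (j + 1)) * (1 + 1 / q ^ 2)| :=
        abs_sub_le _ _ _
    _ ≤ (C + j + 4) * (1 / q ^ 3) * (N * D) := by
        have e : N * (C / q ^ 3 * D) = C * (N * D * (1 / q ^ 3)) := by ring
        rw [e] at hS
        linarith
    _ ≤ (C + j + 4) * (1 / q ^ 3) * (2 * (D * (N - N / q ^ (j + 1)))) :=
        mul_le_mul_of_nonneg_left hfin (by positivity)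
    _ = _ := by ring

universe u v

/-- For an indecomposable alternating form `ω` of degree `k`, the number of tuples on which `ω`
does not vanish is `1 + q⁻² + O(q⁻³)` times the number for a nonzero decomposable form. -/
theorem exists_abs_nonvanishing_sub_le (k : ℕ) :
    ∃ C : ℝ, 0 ≤ C ∧ ∀ (F : Type u) [Field F] [Fintype F] (V : Type v) [AddCommGroup V]
      [Module F V] [Fintype V] (ω : V [⋀^Fin k]→ₗ[F] F), ¬ IsDecomposable ω →
      |(nonvanishing ω : ℝ) - frameCount (Fintype.card F) (finrank F V) k *
          (1 + 1 / (Fintype.card F : ℝ) ^ 2)| ≤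
        C / (Fintype.card F : ℝ) ^ 3 * frameCount (Fintype.card F) (finrank F V) k := by
  induction k with
  | zero => exact ⟨0, le_rfl, fun F _ _ V _ _ _ ω h => (h (isDecomposable_fin_zero ω)).elim⟩
  | succ k ih =>
    obtain _ | _ | k := k
    · exact ⟨0, le_rfl, fun F _ _ V _ _ _ ω h => (h (isDecomposable_fin_one ω)).elim⟩
    -- In degree 2 every contraction is a 1-form, hence decomposable, so the count is exact in terms
    -- of the rank, which is at least 3.
    · refine ⟨2, by norm_num, fun F _ _ V _ _ _ ω h => ?_⟩
      have hq : (2 : ℝ) ≤ Fintype.card F := by exact_mod_cast Fintype.one_lt_card (α := F)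
      rw [isDecomposable_iff, not_le] at h
      have h1 : (nonvanishing ω : ℝ) = ((Fintype.card F : ℝ) ^ finrank F V -
          (Fintype.card F : ℝ) ^ finrank F V / (Fintype.card F : ℝ) ^
            finrank F (LinearMap.range ω.curryLeft)) *
          frameCount (Fintype.card F) (finrank F V) 1 := by
        classical
        have h2 : ∀ v, (nonvanishing (ω.curryLeft v) : ℝ) =
            if ω.curryLeft v ≠ 0 then frameCount (Fintype.card F) (finrank F V) 1 else 0 := by
          intro v
          split_ifs with hv
          · exact nonvanishing_of_isDecomposable _ hv (isDecomposable_fin_one _)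
          · rw [not_not.1 hv, nonvanishing_zero, Nat.cast_zero]
        rw [nonvanishing_succ, Nat.cast_sum, Finset.sum_congr rfl fun v _ => h2 v,
          ← Finset.sum_filter, Finset.sum_const, nsmul_eq_mul, ← Fintype.card_subtype,
          ← Nat.card_eq_fintype_card, card_ne_zero_eq]
      rw [h1, frameCount_succ _ _ 1]
      exact abs_mul_one_sub_le (N := (Fintype.card F : ℝ) ^ finrank F V) (by positivity)
        (frameCount_nonneg (one_le_two.trans hq) _ _) hq h rfl
    · obtain ⟨C, hC, hbound⟩ := ih
      refine ⟨2 * (C + (k + 2 : ℕ) + 4), by positivity, fun F _ _ V _ _ _ ω h => ?_⟩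
      classical
      have hq : (2 : ℝ) ≤ Fintype.card F := by exact_mod_cast Fintype.one_lt_card (α := F)
      have hm : k + 3 + 1 ≤ finrank F (LinearMap.range ω.curryLeft) := by
        rw [isDecomposable_iff, not_le] at h
        exact h
      obtain ⟨v₀, hv₀⟩ : ∃ v, ¬ IsDecomposable (ω.curryLeft v) := by
        by_contra! h0
        exact h (isDecomposable_of_forall_curryLeft h0)
      have hcard : (Fintype.card V : ℝ) = (Fintype.card F : ℝ) ^ finrank F V := by
        rw [Module.card_eq_pow_finrank (K := F), Nat.cast_pow]
      set q : ℝ := (Fintype.card F : ℝ) with hqdef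
      set N : ℝ := q ^ finrank F V
      set D : ℝ := frameCount q (finrank F V) (k + 2)
      have hD : 0 ≤ D := frameCount_nonneg (by linarith) _ _
      have hA : q * (Nat.card {v // IsDecomposable (ω.curryLeft v)} : ℝ) ≤
          ((k + 2 : ℕ) + 1) * N := by
        have h1 := card_mul_card_isDecomposable_le ω.curryLeft v₀ hv₀
        rw [← hcard, hqdef]
        have h2 : (k + 1 + 2 : ℕ) = k + 2 + 1 := rfl
        rw [h2] at h1
        exact_mod_cast h1
      -- The zero contraction is also decomposable: its error `D (1 + q⁻²)` is split between the
      -- last two terms.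
      have hpt : ∀ v, |(nonvanishing (ω.curryLeft v) : ℝ) - D * (1 + 1 / q ^ 2)| ≤
          C / q ^ 3 * D + (if IsDecomposable (ω.curryLeft v) then 1 / q ^ 2 * D else 0) +
            (if ω.curryLeft v = 0 then D else 0) := by
        intro v
        have hp1 : 0 ≤ C / q ^ 3 * D := by positivity
        have hp2 : 0 ≤ 1 / q ^ 2 * D := by positivity
        by_cases hv : ω.curryLeft v = 0
        · have hdec : IsDecomposable (ω.curryLeft v) := ⟨0, 0, fun w => by simp [hv]⟩
          rw [if_pos hv, if_pos hdec, hv, nonvanishing_zero, Nat.cast_zero, zero_sub, abs_neg,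
            abs_of_nonneg (by positivity)]
          linarith
        · rw [if_neg hv]
          by_cases hdec : IsDecomposable (ω.curryLeft v)
          · rw [if_pos hdec, nonvanishing_of_isDecomposable _ hv hdec]
            have e : D - D * (1 + 1 / q ^ 2) = -(1 / q ^ 2 * D) := by ring
            rw [e, abs_neg, abs_of_nonneg hp2]
            linarith
          · rw [if_neg hdec, add_zero, add_zero]
            exact hbound F V _ hdec
      rw [frameCount_succ]
      refine abs_sum_sub_le (by positivity) hD hq hC (by omega)
        (show 3 ≤ finrank F (LinearMap.range ω.curryLeft) by omega) hA ?_
      rw [← card_ker_eq]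
      change |_ - N * (D * _)| ≤ N * (_ * D) + _ * (_ * D) + _ * D
      rw [← hcard, nonvanishing_succ, Nat.cast_sum]
      calc |∑ v, (nonvanishing (ω.curryLeft v) : ℝ) - Fintype.card V * (D * (1 + 1 / q ^ 2))|
          = |∑ v, ((nonvanishing (ω.curryLeft v) : ℝ) - D * (1 + 1 / q ^ 2))| := by
            rw [Finset.sum_sub_distrib, Finset.sum_const, nsmul_eq_mul, Finset.card_univ]
        _ ≤ ∑ v, |(nonvanishing (ω.curryLeft v) : ℝ) - D * (1 + 1 / q ^ 2)| :=
            Finset.abs_sum_le_sum_abs _ _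
        _ ≤ _ := Finset.sum_le_sum fun v _ => hpt v
        _ = _ := by
            rw [Finset.sum_add_distrib, Finset.sum_add_distrib, ← Finset.sum_filter,
              ← Finset.sum_filter, Finset.sum_const, Finset.sum_const, Finset.sum_const,
              nsmul_eq_mul, nsmul_eq_mul, nsmul_eq_mul, Finset.card_univ, ← Fintype.card_subtype,
              ← Fintype.card_subtype, Nat.card_eq_fintype_card, Nat.card_eq_fintype_card]

end Bounds

/-! ### The pairing between the exterior powers of `V*` and `V` -/

section Pairing

variable {F : Type*} [Field F] {V : Type*} [AddCommGroup V] [Module F V]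

theorem exists_dual_family {k : ℕ} {v : Fin k → V} (hv : LinearIndependent F v) :
    ∃ f : Fin k → Dual F V, ∀ i j, f j (v i) = if i = j then 1 else 0 := by
  have h : LinearMap.ker (Fintype.linearCombination F v) = ⊥ := by
    refine LinearMap.ker_eq_bot'.2 fun c hc => ?_
    exact funext (Fintype.linearIndependent_iff.1 hv c hc)
  obtain ⟨B, hB⟩ := LinearMap.exists_leftInverse_of_injective _ h
  refine ⟨fun j => LinearMap.proj j ∘ₗ B, fun i j => ?_⟩
  have h1 : B (v i) = Pi.single i 1 := by
    have := LinearMap.congr_fun hB (Pi.single i 1)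
    rwa [LinearMap.comp_apply, Fintype.linearCombination_apply_single, one_smul] at this
  rw [LinearMap.comp_apply, h1, LinearMap.proj_apply, Pi.single_apply]
  simp only [eq_comm]

theorem ιMulti_ne_zero_iff {k : ℕ} {v : Fin k → V} :
    exteriorPower.ιMulti F k v ≠ 0 ↔ LinearIndependent F v := by
  constructor
  · intro h
    by_contra hv
    exact h ((exteriorPower.ιMulti F k).map_linearDependent v hv)
  · intro hv h
    obtain ⟨f, hf⟩ := exists_dual_family hv
    have h1 := exteriorPower.pairingDual_ιMulti_ιMulti f v
    rw [h, map_zero] at h1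
    have h2 : (Matrix.of fun i j => f j (v i)) = 1 := by
      ext i j
      rw [Matrix.of_apply, hf, Matrix.one_apply]
    rw [h2, Matrix.det_one] at h1
    exact zero_ne_one h1

theorem mk_mem_grassmannian_iff {k : ℕ} {x : ⋀[F]^k V} (hx : x ≠ 0) :
    Projectivization.mk F x hx ∈ grassmannian F V k ↔
      ∃ (c : F) (v : Fin k → V), x = c • exteriorPower.ιMulti F k v := by
  constructor
  · rintro ⟨Λ, b, hb⟩
    rw [Projectivization.submodule_mk] at hb
    obtain ⟨c, hc⟩ := Submodule.mem_span_singleton.1 (hb ▸ Submodule.mem_span_singleton_self x)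
    exact ⟨c, _, hc.symm⟩
  · rintro ⟨c, v, rfl⟩
    have hc : c ≠ 0 := fun h => hx (by rw [h, zero_smul])
    have hv : LinearIndependent F v := ιMulti_ne_zero_iff.1 fun h => hx (by rw [h, smul_zero])
    refine ⟨Submodule.span F (Set.range v), Basis.span hv, ?_⟩
    rw [Projectivization.submodule_mk, Submodule.span_singleton_smul_eq (IsUnit.mk0 c hc)]
    simp only [Basis.span_apply]

/-- The alternating form attached to an element of `⋀^k V*`. -/
def toForm {k : ℕ} : ⋀[F]^k (Dual F V) →ₗ[F] V [⋀^Fin k]→ₗ[F] F :=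
  exteriorPower.alternatingMapLinearEquiv.symm.toLinearMap ∘ₗ exteriorPower.pairingDual F V k

theorem toForm_apply {k : ℕ} (ω : ⋀[F]^k (Dual F V)) (v : Fin k → V) :
    toForm ω v = exteriorPower.pairingDual F V k ω (exteriorPower.ιMulti F k v) := by
  simp [toForm]

variable [FiniteDimensional F V]

/-- The coordinate functionals of the exterior power basis are in the range; injectivity then
follows by comparing dimensions. -/
theorem pairingDual_bijective (k : ℕ) : Function.Bijective (exteriorPower.pairingDual F V k) := by
  have hsurj : Function.Surjective (exteriorPower.pairingDual F V k) := by
    rw [← LinearMap.range_eq_top, eq_top_iff]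
    intro φ _
    let b := (finBasis F V).exteriorPower k
    rw [← b.sum_dual_apply_smul_coord φ]
    refine Submodule.sum_mem _ fun s _ => Submodule.smul_mem _ _ ?_
    rw [exteriorPower.basis_coord]
    exact ⟨_, rfl⟩
  have hfin : finrank F (⋀[F]^k (Dual F V)) = finrank F (Dual F (⋀[F]^k V)) := by
    rw [Subspace.dual_finrank_eq, exteriorPower.finrank_eq, exteriorPower.finrank_eq,
      Subspace.dual_finrank_eq]
  exact ⟨(LinearMap.injective_iff_surjective_of_finrank_eq_finrank hfin).2 hsurj, hsurj⟩

theorem toForm_injective (k : ℕ) : Function.Injective (toForm (F := F) (V := V) (k := k)) :=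
  exteriorPower.alternatingMapLinearEquiv.symm.injective.comp (pairingDual_bijective k).1

theorem isDecomposable_toForm_iff {k : ℕ} {ω : ⋀[F]^k (Dual F V)} :
    IsDecomposable (toForm ω) ↔
      ∃ (c : F) (f : Fin k → Dual F V), ω = c • exteriorPower.ιMulti F k f := by
  constructor
  · rintro ⟨c, f, h⟩
    refine ⟨c, f, toForm_injective k ?_⟩
    ext v
    rw [h, map_smul, AlternatingMap.smul_apply, toForm_apply,
      exteriorPower.pairingDual_ιMulti_ιMulti, smul_eq_mul]
  · rintro ⟨c, f, rfl⟩
    refine ⟨c, f, fun v => ?_⟩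
    rw [map_smul, AlternatingMap.smul_apply, toForm_apply,
      exteriorPower.pairingDual_ιMulti_ιMulti, smul_eq_mul]

theorem annInGrassmannian_iff {k : ℕ} (L : Submodule F (⋀[F]^k V)) :
    AnnInGrassmannian L ↔ ∀ ω ∈ ann L, IsDecomposable (toForm ω) := by
  simp only [isDecomposable_toForm_iff]
  constructor
  · intro h ω hω
    by_cases h0 : ω = 0
    · exact ⟨0, 0, by simp [h0]⟩
    · exact (mk_mem_grassmannian_iff h0).1
        (h ((Submodule.mk_mem_projectivization_iff (ann L) h0).2 hω))
  · intro h P hP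
    induction P using Projectivization.ind with
    | h ω h0 =>
      exact (mk_mem_grassmannian_iff h0).2
        (h ω ((Submodule.mk_mem_projectivization_iff (ann L) h0).1 hP))

omit [FiniteDimensional F V] in
theorem ann_eq_comap {k : ℕ} (L : Submodule F (⋀[F]^k V)) :
    ann L = L.dualAnnihilator.comap (exteriorPower.pairingDual F V k) := by
  ext ω
  rw [Submodule.mem_comap, Submodule.mem_dualAnnihilator]
  rfl

theorem finrank_ann {k : ℕ} (L : Submodule F (⋀[F]^k V)) :
    finrank F (ann L) = finrank F (↥(⋀[F]^k V) ⧸ L) := by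
  let e := LinearEquiv.ofBijective _ (pairingDual_bijective (F := F) (V := V) k)
  have h1 : (ann L).map e.toLinearMap = L.dualAnnihilator := by
    rw [ann_eq_comap]
    exact Submodule.map_comap_eq_of_surjective e.surjective _
  rw [← LinearEquiv.finrank_map_eq e (ann L)]
  change finrank F ((ann L).map e.toLinearMap) = _
  rw [h1, ← L.dualQuotEquivDualAnnihilator.finrank_eq, Subspace.dual_finrank_eq]

theorem exists_mem_ann_pairingDual_ne_zero {k : ℕ} {L : Submodule F (⋀[F]^k V)}
    {x : ⋀[F]^k V} (hx : x ∉ L) :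
    ∃ ω ∈ ann L, exteriorPower.pairingDual F V k ω x ≠ 0 := by
  obtain ⟨φ, hφ, hL⟩ := Submodule.exists_le_ker_of_notMem hx
  obtain ⟨ω, rfl⟩ := (pairingDual_bijective k).2 φ
  exact ⟨ω, fun ξ hξ => hL hξ, hφ⟩

end Pairing

/-! ### Points of the Grassmannian and the tuples representing them -/

section Points

variable {F : Type*} [Field F] {V : Type*} [AddCommGroup V] [Module F V]

/-- If `w i` were outside the span of `v`, functionals dual to `v` and vanishing on `w i` would pair
to 1 with `⋀ v` and to 0 with `⋀ w`, the latter through a zero row. -/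
theorem span_le_of_span_ιMulti_eq {k : ℕ} {v w : Fin k → V} (hv : LinearIndependent F v)
    (h : Submodule.span F {exteriorPower.ιMulti F k v} =
      Submodule.span F {exteriorPower.ιMulti F k w}) (i : Fin k) :
    w i ∈ Submodule.span F (Set.range v) := by
  by_contra hi
  obtain ⟨f, hf⟩ := exists_dual_family (linearIndependent_finCons.2 ⟨hv, hi⟩)
  obtain ⟨c, hc⟩ := Submodule.mem_span_singleton.1
    (h ▸ Submodule.mem_span_singleton_self (exteriorPower.ιMulti F k v))
  have h1 := exteriorPower.pairingDual_ιMulti_ιMulti (fun j : Fin k => f j.succ) v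
  have h2 := exteriorPower.pairingDual_ιMulti_ιMulti (fun j : Fin k => f j.succ) w
  have h3 : (Matrix.of fun i j : Fin k => f j.succ (v i)) = 1 := by
    ext i j
    rw [Matrix.of_apply, Matrix.one_apply]
    simpa [Fin.succ_inj] using hf i.succ j.succ
  rw [h3, Matrix.det_one, ← hc, map_smul, h2, Matrix.det_eq_zero_of_row_eq_zero i, smul_zero] at h1
  · exact zero_ne_one h1
  · intro j
    simpa [(Fin.succ_ne_zero j).symm] using hf 0 j.succ

/-- The top exterior power of `Λ` is a line, and the inclusion of `Λ` carries proportionality to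
`⋀^k V`. -/
theorem span_ιMulti_eq_of_mem {k : ℕ} {Λ : Submodule F V} (b : Basis (Fin k) F Λ)
    {s : Fin k → Λ} (hs : LinearIndependent F s) :
    Submodule.span F {exteriorPower.ιMulti F k fun i => (s i : V)} =
      Submodule.span F {exteriorPower.ιMulti F k fun i => (b i : V)} := by
  have : FiniteDimensional F Λ := b.finiteDimensional_of_finite
  have h1 : finrank F (⋀[F]^k Λ) = 1 := by
    rw [exteriorPower.finrank_eq, finrank_eq_card_basis b, Fintype.card_fin, Nat.choose_self]
  obtain ⟨c, hc⟩ := exists_smul_eq_of_finrank_eq_one h1 (ιMulti_ne_zero_iff.2 b.linearIndependent)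
    (exteriorPower.ιMulti F k s)
  have hc0 : c ≠ 0 := by
    rintro rfl
    rw [zero_smul] at hc
    exact ιMulti_ne_zero_iff.2 hs hc.symm
  have h2 := congrArg (exteriorPower.map k Λ.subtype) hc
  rw [map_smul, exteriorPower.map_apply_ιMulti, exteriorPower.map_apply_ιMulti] at h2
  change c • exteriorPower.ιMulti F k (fun i => (b i : V)) =
    exteriorPower.ιMulti F k (fun i => (s i : V)) at h2
  rw [← h2, Submodule.span_singleton_smul_eq (IsUnit.mk0 c hc0)]

variable [Fintype F] [Finite V]

/-- The tuples representing a point are exactly the ordered bases of its subspace, which number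
`|GL_k(q)|`. -/
theorem card_fiber {k : ℕ} {P : ℙ F (⋀[F]^k V)} (hP : P ∈ grassmannian F V k) :
    Nat.card {v : Fin k → V // Submodule.span F {exteriorPower.ιMulti F k v} = P.submodule} =
      ∏ i : Fin k, (Fintype.card F ^ k - Fintype.card F ^ (i : ℕ)) := by
  obtain ⟨Λ, b, hb⟩ := hP
  have hk : finrank F Λ = k := by rw [finrank_eq_card_basis b, Fintype.card_fin]
  have h1 := card_linearIndependent (K := F) (V := Λ) hk.ge
  rw [hk] at h1
  rw [← h1, eq_comm]
  refine Nat.card_eq_of_bijective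
    (fun s => ⟨fun i => (s.1 i : V), (span_ιMulti_eq_of_mem b s.2).trans hb.symm⟩) ⟨?_, ?_⟩
  · rintro ⟨s, hs⟩ ⟨t, ht⟩ hst
    refine Subtype.ext (funext fun i => Subtype.ext ?_)
    exact congrFun (congrArg Subtype.val hst) i
  · rintro ⟨v, hv⟩
    have hbl : LinearIndependent F fun i => (b i : V) :=
      b.linearIndependent.map' Λ.subtype (Submodule.ker_subtype _)
    have hmem : ∀ i, v i ∈ Λ := fun i => by
      refine Submodule.span_le.2 ?_ (span_le_of_span_ιMulti_eq hbl (hb.symm.trans hv.symm) i)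
      rintro _ ⟨j, rfl⟩
      exact (b j).2
    have hvl : LinearIndependent F v := by
      rw [← ιMulti_ne_zero_iff]
      intro h0
      rw [h0, Submodule.span_zero_singleton, eq_comm] at hv
      have := P.finrank_submodule
      rw [hv, finrank_bot] at this
      exact zero_ne_one this
    exact ⟨⟨fun i => ⟨v i, hmem i⟩, LinearIndependent.of_comp Λ.subtype hvl⟩, rfl⟩

theorem weight_mul_eq {k : ℕ} (L : Submodule F (⋀[F]^k V)) :
    weight L * ∏ i : Fin k, (Fintype.card F ^ k - Fintype.card F ^ (i : ℕ)) =
      Nat.card {v : Fin k → V // exteriorPower.ιMulti F k v ∉ L} := by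
  classical
  have : Finite (⋀[F]^k V) := Module.finite_of_finite F
  have : Fintype (grassmannian F V k \ (L.projectivization : Set (ℙ F (⋀[F]^k V))) : Set _) :=
    Fintype.ofFinite _
  have hne : ∀ v : Fin k → V, exteriorPower.ιMulti F k v ∉ L → exteriorPower.ιMulti F k v ≠ 0 :=
    fun v hv h => hv (h ▸ L.zero_mem)
  let φ : {v : Fin k → V // exteriorPower.ιMulti F k v ∉ L} →
      (grassmannian F V k \ (L.projectivization : Set (ℙ F (⋀[F]^k V))) : Set _) := fun v =>
    ⟨Projectivization.mk F _ (hne v.1 v.2),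
      (mk_mem_grassmannian_iff _).2 ⟨1, v.1, (one_smul _ _).symm⟩,
      fun h => v.2 ((Submodule.mk_mem_projectivization_iff L _).1 h)⟩
  have hfib : ∀ P, Nat.card {v // φ v = P} =
      ∏ i : Fin k, (Fintype.card F ^ k - Fintype.card F ^ (i : ℕ)) := by
    rintro ⟨P, hP, hPL⟩
    rw [← card_fiber hP]
    refine Nat.card_eq_of_bijective (fun v => ⟨v.1.1, ?_⟩) ⟨?_, ?_⟩
    · have h := congrArg (fun Q => Q.1.submodule) v.2
      exact h
    · intro v w hvw
      have h : v.1.1 = w.1.1 := Subtype.mk.inj hvw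
      exact Subtype.ext (Subtype.ext h)
    · rintro ⟨v, hv⟩
      have hvL : exteriorPower.ιMulti F k v ∉ L := by
        intro h
        refine hPL ((Submodule.mem_projectivization_iff_submodule_le L P).2 ?_)
        rw [← hv, Submodule.span_singleton_le_iff_mem]
        exact h
      refine ⟨⟨⟨v, hvL⟩, Subtype.ext (Projectivization.submodule_injective ?_)⟩, rfl⟩
      exact hv
  rw [← Nat.card_congr (Equiv.sigmaFiberEquiv φ), Nat.card_sigma,
    Finset.sum_congr rfl fun P _ => hfib P, Finset.sum_const, smul_eq_mul, weight, Finset.card_univ,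
    ← Nat.card_coe_set_eq, Nat.card_eq_fintype_card]

end Points

/-! ### Averaging over the annihilator -/

section Averaging

variable {F : Type*} [Field F] [Fintype F] {V : Type*} [AddCommGroup V] [Module F V] [Fintype V]

omit [Fintype V] in
theorem card_submodule_ne_zero {U : Type*} [AddCommGroup U] [Module F U] (W : Submodule F U)
    [Fintype W] (T : U →ₗ[F] F) {x : U} (hx : x ∈ W) (hT : T x ≠ 0) :
    (Nat.card {w : W // T w ≠ 0} : ℝ) = (Fintype.card F : ℝ) ^ finrank F W -
      (Fintype.card F : ℝ) ^ finrank F W / Fintype.card F := by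
  have hr : LinearMap.range (T ∘ₗ W.subtype) = ⊤ := by
    rw [LinearMap.range_eq_top]
    refine LinearMap.surjective fun h0 => ?_
    exact hT (LinearMap.congr_fun h0 ⟨x, hx⟩)
  refine (card_ne_zero_eq (T ∘ₗ W.subtype)).trans ?_
  rw [hr, finrank_top, finrank_self, pow_one]

theorem card_mul_card_submodule_isDecomposable_le {U : Type*} [AddCommGroup U] [Module F U]
    (W : Submodule F U) [Fintype W] {k : ℕ} (T : U →ₗ[F] V [⋀^Fin (k + 1)]→ₗ[F] F) {x : U}
    (hx : x ∈ W) (hT : ¬ IsDecomposable (T x)) :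
    Fintype.card F * Nat.card {w : W // IsDecomposable (T w)} ≤
      (k + 2) * Fintype.card F ^ finrank F W := by
  rw [← Module.card_eq_pow_finrank (K := F) (V := W)]
  exact card_mul_card_isDecomposable_le (T ∘ₗ W.subtype) ⟨x, hx⟩ hT

/-- Double counting of pairs `(ω, v)` with `ω v ≠ 0`. For fixed `v`, evaluation is a linear
functional on `ann L`, nonzero exactly when the wedge of `v` is outside `L`. -/
theorem sum_nonvanishing_eq {k : ℕ} (L : Submodule F (⋀[F]^k V)) [Fintype (ann L)] :
    ∑ ω : ann L, (nonvanishing (toForm (ω : ⋀[F]^k (Dual F V))) : ℝ) =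
      Nat.card {v : Fin k → V // exteriorPower.ιMulti F k v ∉ L} *
        ((Fintype.card F : ℝ) ^ finrank F (ann L) -
          (Fintype.card F : ℝ) ^ finrank F (ann L) / Fintype.card F) := by
  classical
  have hv : ∀ v : Fin k → V,
      (Nat.card {ω : ann L // toForm (ω : ⋀[F]^k (Dual F V)) v ≠ 0} : ℝ) =
      if exteriorPower.ιMulti F k v ∉ L then ((Fintype.card F : ℝ) ^ finrank F (ann L) -
          (Fintype.card F : ℝ) ^ finrank F (ann L) / Fintype.card F) else 0 := by
    intro v
    simp only [toForm_apply]
    split_ifs with h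
    · have : IsEmpty {ω : ann L //
          exteriorPower.pairingDual F V k ω (exteriorPower.ιMulti F k v) ≠ 0} :=
        ⟨fun ω => ω.2 (ω.1.2 _ h)⟩
      simp
    · obtain ⟨ω, hω, hne⟩ := exists_mem_ann_pairingDual_ne_zero h
      exact card_submodule_ne_zero (ann L)
        ((exteriorPower.pairingDual F V k).flip (exteriorPower.ιMulti F k v)) hω hne
  have hswap : ∑ ω : ann L, nonvanishing (toForm (ω : ⋀[F]^k (Dual F V))) =
      ∑ v : Fin k → V, Nat.card {ω : ann L // toForm (ω : ⋀[F]^k (Dual F V)) v ≠ 0} := by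
    unfold nonvanishing
    rw [← Nat.card_sigma, ← Nat.card_sigma]
    exact Nat.card_congr
      { toFun := fun p => ⟨p.2.1, p.1, p.2.2⟩
        invFun := fun p => ⟨p.2.1, p.1, p.2.2⟩
        left_inv := fun _ => rfl
        right_inv := fun _ => rfl }
  rw [← Nat.cast_sum, hswap, Nat.cast_sum, Finset.sum_congr rfl fun v _ => hv v,
    ← Finset.sum_filter, Finset.sum_const, nsmul_eq_mul, ← Fintype.card_subtype,
    ← Nat.card_eq_fintype_card]

/-- Each of the `k` factors contributes `q^(n-k)`; what remains is `|GL_k(q)|` with its factors in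
reverse order. -/
theorem frameCount_eq {q : ℝ} (hq : q ≠ 0) {n k : ℕ} (hkn : k ≤ n) :
    frameCount q n k = q ^ delta k n * ∏ i : Fin k, (q ^ k - q ^ (i : ℕ)) := by
  have h1 : q ^ delta k n = (q ^ (n - k)) ^ k := by
    rw [delta, ← Nat.cast_sub hkn, ← pow_mul, mul_comm (n - k), ← zpow_natCast, Nat.cast_mul]
  rw [h1, Fin.prod_univ_eq_prod_range (fun i => q ^ k - q ^ i), ← Finset.prod_range_reflect,
    frameCount]
  conv_rhs => rw [← Finset.card_range k]
  rw [← Finset.prod_const, Finset.card_range, ← Finset.prod_mul_distrib]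
  refine Finset.prod_congr rfl fun i hi => ?_
  have hi' := Finset.mem_range.1 hi
  have e1 : q ^ n = q ^ (n - k) * q ^ k := by rw [← pow_add, Nat.sub_add_cancel hkn]
  have e2 : q ^ k = q ^ (k - 1 - i) * q ^ (i + 1) := by
    rw [← pow_add]; congr 1; omega
  rw [mul_sub, e1, sub_right_inj, mul_div_assoc]
  congr 1
  rw [div_eq_iff (pow_ne_zero _ hq), e2]

/-- The weight of `L`, as an average over the annihilator of `L`. -/
theorem weight_mul_frameCount {k : ℕ} (hk : k ≤ finrank F V) (L : Submodule F (⋀[F]^k V))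
    [Fintype (ann L)] :
    (weight L : ℝ) * frameCount (Fintype.card F) (finrank F V) k *
      ((Fintype.card F : ℝ) ^ finrank F (ann L) * (1 - 1 / Fintype.card F)) =
    (Fintype.card F : ℝ) ^ delta k (finrank F V) *
      ∑ ω : ann L, (nonvanishing (toForm (ω : ⋀[F]^k (Dual F V))) : ℝ) := by
  have hq : (Fintype.card F : ℝ) ≠ 0 := by simp
  have h1 : (weight L : ℝ) * ∏ i : Fin k, ((Fintype.card F : ℝ) ^ k - (Fintype.card F : ℝ) ^ (i : ℕ))
      = Nat.card {v : Fin k → V // exteriorPower.ιMulti F k v ∉ L} := by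
    rw [← weight_mul_eq, Nat.cast_mul, Nat.cast_prod]
    congr 1
    refine Finset.prod_congr rfl fun i _ => ?_
    rw [Nat.cast_sub (Nat.pow_le_pow_right Fintype.card_pos i.2.le), Nat.cast_pow, Nat.cast_pow]
  rw [sum_nonvanishing_eq, ← h1, frameCount_eq hq hk]
  ring

theorem frameCount_pos {q : ℝ} (hq : 1 < q) (n k : ℕ) : 0 < frameCount q n k :=
  Finset.prod_pos fun i _ =>
    sub_pos.2 (div_lt_self (by positivity) (one_lt_pow₀ hq (by omega)))

theorem weight_eq_of_annInGrassmannian {k : ℕ} (hk : k ≤ finrank F V)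
    (L : Submodule F (⋀[F]^k V)) (h : AnnInGrassmannian L) :
    (weight L : ℝ) = ∑ i ∈ Finset.range (finrank F (ann L)),
      (Fintype.card F : ℝ) ^ (delta k (finrank F V) - (i : ℤ)) := by
  classical
  have : Finite (⋀[F]^k (Dual F V)) := Module.finite_of_finite F
  have : Fintype (ann L) := Fintype.ofFinite _
  rw [annInGrassmannian_iff] at h
  have hq1 : (1 : ℝ) < Fintype.card F := by exact_mod_cast Fintype.one_lt_card (α := F)
  have hmain := weight_mul_frameCount hk L
  have hcard : (Fintype.card (ann L) : ℝ) = (Fintype.card F : ℝ) ^ finrank F (ann L) := by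
    rw [Module.card_eq_pow_finrank (K := F), Nat.cast_pow]
  -- Every form but zero contributes `frameCount`, so `‖L‖` is `q^δ (1 - q⁻ʳ) / (1 - q⁻¹)`, a finite
  -- geometric sum.
  have hsum : ∑ ω : ann L, (nonvanishing (toForm (ω : ⋀[F]^k (Dual F V))) : ℝ) =
      ((Fintype.card F : ℝ) ^ finrank F (ann L) - 1) *
        frameCount (Fintype.card F) (finrank F V) k := by
    rw [← hcard, ← Finset.sum_erase (a := (0 : ann L)) Finset.univ (by
      rw [ZeroMemClass.coe_zero, map_zero, nonvanishing_zero, Nat.cast_zero]),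
      Finset.sum_congr rfl fun ω hω => nonvanishing_of_isDecomposable _ (fun h0 =>
        Finset.ne_of_mem_erase hω (Subtype.ext (toForm_injective k (h0.trans (map_zero _).symm))))
        (h ω.1 ω.2), Finset.sum_const, nsmul_eq_mul, Finset.card_erase_of_mem (Finset.mem_univ _),
      Finset.card_univ, Nat.cast_sub Fintype.card_pos, Nat.cast_one]
  have hD := frameCount_pos hq1 (finrank F V) k
  rw [hsum] at hmain
  set q : ℝ := (Fintype.card F : ℝ) with hqdef
  set r := finrank F (ann L)
  have hq0 : q ≠ 0 := by positivity
  have hgeom : ∑ i ∈ Finset.range r, q ^ (delta k (finrank F V) - (i : ℤ)) =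
      q ^ delta k (finrank F V) * ∑ i ∈ Finset.range r, (1 / q) ^ i := by
    rw [Finset.mul_sum]
    refine Finset.sum_congr rfl fun i _ => ?_
    rw [zpow_sub₀ hq0, zpow_natCast, one_div, inv_pow, div_eq_mul_inv]
  have hg2 := mul_neg_geom_sum (1 / q) r
  have h1 : 0 < 1 - 1 / q := by
    rw [sub_pos, div_lt_one (by positivity)]
    exact hq1
  rw [hgeom]
  refine mul_right_cancel₀ (b := frameCount q (finrank F V) k * (q ^ r * (1 - 1 / q)))
    (by positivity) ?_
  calc (weight L : ℝ) * (frameCount q (finrank F V) k * (q ^ r * (1 - 1 / q)))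
      = q ^ delta k (finrank F V) * ((q ^ r - 1) * frameCount q (finrank F V) k) := by
        rw [← hmain]; ring
    _ = q ^ delta k (finrank F V) * frameCount q (finrank F V) k * (q ^ r * (1 - (1 / q) ^ r)) := by
        have e : q ^ r * (1 - (1 / q) ^ r) = q ^ r - 1 := by
          rw [mul_sub, ← mul_pow, mul_one_div_cancel hq0, one_pow, mul_one]
        rw [e]; ring
    _ = _ := by rw [← hg2]; ring

theorem card_mul_card_isDecomposable_ann_le {k : ℕ} (L : Submodule F (⋀[F]^k V))
    {ω₀ : ⋀[F]^k (Dual F V)} (hω₀ : ω₀ ∈ ann L) (h : ¬ IsDecomposable (toForm ω₀)) :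
    (Fintype.card F : ℝ) *
      (Nat.card {ω : ann L // IsDecomposable (toForm (ω : ⋀[F]^k (Dual F V)))} : ℝ) ≤
        (k + 1) * (Fintype.card F : ℝ) ^ finrank F (ann L) := by
  obtain _ | k := k
  · exact (h (isDecomposable_fin_zero _)).elim
  have : Finite (⋀[F]^(k + 1) (Dual F V)) := Module.finite_of_finite F
  have : Fintype (ann L) := Fintype.ofFinite _
  have h1 := card_mul_card_submodule_isDecomposable_le (ann L) toForm hω₀ h
  have h2 : k + 2 = k + 1 + 1 := rfl
  rw [h2] at h1
  exact_mod_cast h1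

end Averaging

/-! ### The estimate when the annihilator contains an indecomposable form -/

section Estimate

/-- Here `(1 + y + 2y²)(1 - y) = 1 + y² - 2y³`, and `yʳ ≤ y³`. Dividing by `1 - y ≥ 1/2` doubles the
constant `E + 2`. -/
theorem abs_sub_le_of_three_le {x y E : ℝ} {r : ℕ} (hy : 0 < y) (hy' : y ≤ 1 / 2) (hr : 3 ≤ r)
    (h : |x * (1 - y) - (1 + y ^ 2 - y ^ r)| ≤ E * y ^ 3) :
    |x - (1 + y + 2 * y ^ 2)| ≤ (2 * E + 4) * y ^ 3 := by
  have h1 : y ^ r ≤ y ^ 3 := pow_le_pow_of_le_one hy.le (by linarith) hr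
  have h2 : 0 < y ^ r := by positivity
  have h3 : |(x - (1 + y + 2 * y ^ 2)) * (1 - y)| ≤ (E + 2) * y ^ 3 := by
    rw [abs_le] at h ⊢
    constructor <;> nlinarith [h.1, h.2]
  rw [abs_mul, abs_of_nonneg (by linarith : 0 ≤ 1 - y)] at h3
  have h4 := abs_nonneg (x - (1 + y + 2 * y ^ 2))
  nlinarith

/-- For `r = 2` the term `yʳ` cancels `y²`, and `(1 + y + y²)(1 - y) = 1 - y³`. The constant is
larger than needed, to agree with the case `r ≥ 3`. -/
theorem abs_sub_le_of_eq_two {x y E : ℝ} (hy : 0 < y) (hy' : y ≤ 1 / 2)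
    (h : |x * (1 - y) - (1 + y ^ 2 - y ^ 2)| ≤ E * y ^ 3) :
    |x - (1 + y + y ^ 2)| ≤ (2 * E + 4) * y ^ 3 := by
  have h2 : 0 < y ^ 3 := by positivity
  have h3 : |(x - (1 + y + y ^ 2)) * (1 - y)| ≤ (E + 2) * y ^ 3 := by
    rw [abs_le] at h ⊢
    constructor <;> nlinarith [h.1, h.2]
  rw [abs_mul, abs_of_nonneg (by linarith : 0 ≤ 1 - y)] at h3
  have h4 := abs_nonneg (x - (1 + y + y ^ 2))
  nlinarith

universe u v

theorem exists_weight_estimate (k : ℕ) :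
    ∃ E : ℝ, ∀ (F : Type u) [Field F] [Fintype F] (V : Type v) [AddCommGroup V] [Module F V]
      [Fintype V] (L : Submodule F (⋀[F]^k V)), k ≤ finrank F V → ¬ AnnInGrassmannian L →
      ∃ x : ℝ, (weight L : ℝ) = x * (Fintype.card F : ℝ) ^ delta k (finrank F V) ∧
        |x * (1 - 1 / Fintype.card F) - (1 + (1 / (Fintype.card F : ℝ)) ^ 2 -
          (1 / (Fintype.card F : ℝ)) ^ finrank F (ann L))| ≤
        E * (1 / (Fintype.card F : ℝ)) ^ 3 := by
  obtain ⟨C, hC, hbound⟩ := exists_abs_nonvanishing_sub_le.{u, v} k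
  refine ⟨C + k + 1, fun F _ _ V _ _ _ L hk h => ?_⟩
  classical
  have : Finite (⋀[F]^k (Dual F V)) := Module.finite_of_finite F
  have : Fintype (ann L) := Fintype.ofFinite _
  have hq : (2 : ℝ) ≤ Fintype.card F := by exact_mod_cast Fintype.one_lt_card (α := F)
  have hmain := weight_mul_frameCount hk L
  have hD := frameCount_pos (one_lt_two.trans_le hq) (finrank F V) k
  have hcard : (Fintype.card (ann L) : ℝ) = (Fintype.card F : ℝ) ^ finrank F (ann L) := by
    rw [Module.card_eq_pow_finrank (K := F), Nat.cast_pow]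
  rw [annInGrassmannian_iff] at h
  push Not at h
  obtain ⟨ω₀, hω₀, hnd⟩ := h
  have hA := card_mul_card_isDecomposable_ann_le L hω₀ hnd
  set q : ℝ := (Fintype.card F : ℝ) with hqdef
  set r := finrank F (ann L)
  set D := frameCount q (finrank F V) k
  have hq0 : 0 < q := by linarith
  -- The zero form is counted as if it contributed `D`, so that it behaves like any decomposable
  -- form; this correction is the source of the term `-q⁻ʳ`.
  have hpt : ∀ ω : ann L, |(nonvanishing (toForm (ω : ⋀[F]^k (Dual F V))) : ℝ) +
      (if ω = 0 then D else 0) - D * (1 + 1 / q ^ 2)| ≤ C / q ^ 3 * D +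
        (if IsDecomposable (toForm (ω : ⋀[F]^k (Dual F V))) then 1 / q ^ 2 * D else 0) := by
    intro ω
    have hp1 : 0 ≤ C / q ^ 3 * D := by positivity
    have hp2 : 0 ≤ 1 / q ^ 2 * D := by positivity
    have e : D - D * (1 + 1 / q ^ 2) = -(1 / q ^ 2 * D) := by ring
    by_cases hdec : IsDecomposable (toForm (ω : ⋀[F]^k (Dual F V)))
    · have h1 : (nonvanishing (toForm (ω : ⋀[F]^k (Dual F V))) : ℝ) +
          (if ω = 0 then D else 0) = D := by
        by_cases h0 : ω = 0
        · rw [if_pos h0, h0, ZeroMemClass.coe_zero, map_zero, nonvanishing_zero, Nat.cast_zero,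
            zero_add]
        · rw [if_neg h0, add_zero]
          exact nonvanishing_of_isDecomposable _ (fun h1 => h0 (Subtype.ext
            (toForm_injective k (h1.trans (map_zero _).symm)))) hdec
      rw [if_pos hdec, h1, e, abs_neg, abs_of_nonneg hp2]
      linarith
    · have h0 : ω ≠ 0 := by
        rintro rfl
        exact hdec ⟨0, 0, fun w => by simp⟩
      rw [if_neg hdec, if_neg h0, add_zero, add_zero]
      exact hbound F V _ hdec
  have hsum : |∑ ω : ann L, (nonvanishing (toForm (ω : ⋀[F]^k (Dual F V))) : ℝ) + D -
      q ^ r * (D * (1 + 1 / q ^ 2))| ≤ q ^ r * (C / q ^ 3 * D) +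
        Nat.card {ω : ann L // IsDecomposable (toForm (ω : ⋀[F]^k (Dual F V)))} *
          (1 / q ^ 2 * D) := by
    rw [← hcard]
    calc _ = |∑ ω : ann L, ((nonvanishing (toForm (ω : ⋀[F]^k (Dual F V))) : ℝ) +
          (if ω = 0 then D else 0) - D * (1 + 1 / q ^ 2))| := by
            rw [Finset.sum_sub_distrib, Finset.sum_add_distrib, Finset.sum_ite_eq',
              if_pos (Finset.mem_univ _), Finset.sum_const, nsmul_eq_mul, Finset.card_univ]
      _ ≤ _ := Finset.abs_sum_le_sum_abs _ _
      _ ≤ _ := Finset.sum_le_sum fun ω _ => hpt ω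
      _ = _ := by
          rw [Finset.sum_add_distrib, ← Finset.sum_filter, Finset.sum_const, Finset.sum_const,
            nsmul_eq_mul, nsmul_eq_mul, Finset.card_univ, ← Fintype.card_subtype,
            Nat.card_eq_fintype_card]
  set S := ∑ ω : ann L, (nonvanishing (toForm (ω : ⋀[F]^k (Dual F V))) : ℝ)
  have hqd : (0 : ℝ) < q ^ delta k (finrank F V) := by positivity
  refine ⟨weight L / q ^ delta k (finrank F V), by field_simp, ?_⟩
  have hx : (weight L : ℝ) / q ^ delta k (finrank F V) * (1 - 1 / q) = S / (D * q ^ r) := by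
    rw [eq_div_iff (by positivity), div_mul_eq_mul_div, div_mul_eq_mul_div, div_eq_iff hqd.ne']
    linarith
  have e1 : S / (D * q ^ r) - (1 + (1 / q) ^ 2 - (1 / q) ^ r) =
      (S + D - q ^ r * (D * (1 + 1 / q ^ 2))) / (D * q ^ r) := by
    rw [one_div_pow (a := q) (n := r)]
    field_simp
    ring
  rw [hx, e1, abs_div, abs_of_pos (by positivity : 0 < D * q ^ r), div_le_iff₀ (by positivity)]
  refine hsum.trans ?_
  have e2 : ∀ A : ℝ, q ^ r * (C / q ^ 3 * D) + A * (1 / q ^ 2 * D) =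
      (C * q ^ r + q * A) * (D * (1 / q) ^ 3) := by
    intro A
    field_simp
  rw [e2]
  -- The constant `C` comes from indecomposable forms. The `k + 1` comes from decomposable ones: a
  -- proportion at most `(k + 1)/q`, each off by `q⁻² D`.
  calc _ ≤ (C * q ^ r + (k + 1) * q ^ r) * (D * (1 / q) ^ 3) :=
        mul_le_mul_of_nonneg_right (by linarith) (by positivity)
    _ = _ := by ring

end Estimate

end PluckerSection

end

/-! ### The three cases of the theorem -/

theorem mainTheorem4 (k n : ℕ) (hkn : k ≤ n) :
    ∃ C : ℝ, ∀ (F : Type*) [Field F] [Fintype F] (r : ℕ)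
      (L : Submodule F (⋀[F]^k (Fin n → F))),
      1 ≤ r → Module.finrank F (↥(⋀[F]^k (Fin n → F)) ⧸ L) = r →
      (PluckerSection.AnnInGrassmannian L →
        (PluckerSection.weight L : ℝ) =
          ∑ i ∈ Finset.range r,
            (Fintype.card F : ℝ) ^ (PluckerSection.delta k n - (i : ℤ))) ∧
      (¬ PluckerSection.AnnInGrassmannian L → 3 ≤ r →
        |(PluckerSection.weight L : ℝ)
            - ((Fintype.card F : ℝ) ^ PluckerSection.delta k n
              + (Fintype.card F : ℝ) ^ (PluckerSection.delta k n - 1)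
              + 2 * (Fintype.card F : ℝ) ^ (PluckerSection.delta k n - 2))|
          ≤ C * (Fintype.card F : ℝ) ^ (PluckerSection.delta k n - 3)) ∧
      (¬ PluckerSection.AnnInGrassmannian L → r = 2 →
        |(PluckerSection.weight L : ℝ)
            - ((Fintype.card F : ℝ) ^ PluckerSection.delta k n
              + (Fintype.card F : ℝ) ^ (PluckerSection.delta k n - 1)
              + (Fintype.card F : ℝ) ^ (PluckerSection.delta k n - 2))|
          ≤ C * (Fintype.card F : ℝ) ^ (PluckerSection.delta k n - 3)) := by
  obtain ⟨E, hE⟩ := PluckerSection.exists_weight_estimate k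
  refine ⟨2 * E + 4, fun F _ _ r L hr hcodim => ?_⟩
  have hn : Module.finrank F (Fin n → F) = n := Module.finrank_fin_fun F
  have hann : Module.finrank F (PluckerSection.ann L) = r :=
    (PluckerSection.finrank_ann L).trans hcodim
  have hq : (2 : ℝ) ≤ Fintype.card F := by exact_mod_cast Fintype.one_lt_card (α := F)
  have hq0 : (Fintype.card F : ℝ) ≠ 0 := by positivity
  have hy : 0 < 1 / (Fintype.card F : ℝ) := by positivity
  have hy' : 1 / (Fintype.card F : ℝ) ≤ 1 / 2 := one_div_le_one_div_of_le (by norm_num) hq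
  have hpow : ∀ i : ℕ, (Fintype.card F : ℝ) ^ (PluckerSection.delta k n - (i : ℤ)) =
      (1 / (Fintype.card F : ℝ)) ^ i * (Fintype.card F : ℝ) ^ PluckerSection.delta k n := by
    intro i
    rw [zpow_sub₀ hq0, zpow_natCast, one_div, inv_pow, div_eq_inv_mul]
  have h1 := hpow 1
  have h2 := hpow 2
  have h3 := hpow 3
  rw [pow_one, Nat.cast_one] at h1
  rw [Nat.cast_ofNat] at h2 h3
  have hpos : 0 < (Fintype.card F : ℝ) ^ PluckerSection.delta k n := by positivity
  refine ⟨fun h => ?_, fun h hr3 => ?_, fun h hr2 => ?_⟩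
  · have := PluckerSection.weight_eq_of_annInGrassmannian (hkn.trans_eq hn.symm) L h
    rwa [hn, hann] at this
  · obtain ⟨x, hx, hxE⟩ := hE F _ L (hkn.trans_eq hn.symm) h
    rw [hn] at hx
    rw [hann] at hxE
    have hfin := PluckerSection.abs_sub_le_of_three_le hy hy' hr3 hxE
    rw [hx, h1, h2, h3, ← mul_assoc (2 * E + 4)]
    refine le_of_eq_of_le ?_ (mul_le_mul_of_nonneg_right hfin hpos.le)
    rw [← abs_of_pos hpos, ← abs_mul, abs_of_pos hpos]
    congr 1
    ring
  · obtain ⟨x, hx, hxE⟩ := hE F _ L (hkn.trans_eq hn.symm) h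
    rw [hn] at hx
    rw [hann, hr2] at hxE
    have hfin := PluckerSection.abs_sub_le_of_eq_two hy hy' hxE
    rw [hx, h1, h2, h3, ← mul_assoc (2 * E + 4)]
    refine le_of_eq_of_le ?_ (mul_le_mul_of_nonneg_right hfin hpos.le)
    rw [← abs_of_pos hpos, ← abs_mul, abs_of_pos hpos]
    congr 1
    ring
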